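/- All algebras are unital and associative over $\mathbb{C}$, and $\otimes=\otimes_{\mathbb{C}}$. An algebra $A$ is *quasi-free* (formally smooth) if for every surjective algebra homomorphism $p:R\to S$ whose kernel $I$ satisfies $I^2=0$, every algebra homomorphism $A\to S$ lifts along $p$ to an algebra homomorphism $A\to R$. For an algebra $A$, let $\mathrm{Der}(A,A^{\otimes 2})$ be the space of linear derivations $A\to A\otimes A$ with respect to the outer bimodule structure $a\cdot(x\otimes y)\cdot b=ax\otimes yb$. It is an $A$-bimodule through the inner structure $a\cdot(x\otimes y)\cdot b=xb\otimes ay$, and it contains the element $\Delta:x\mapsto x\otimes 1-1\otimes x$. For $\lambda\in A$ put $$\Pi^\lambda(A):=T_A\,\mathrm{Der}(A,A^{\otimes 2})/\langle\Delta-\lambda\rangle ,$$ where $T_A$ denotes the tensor algebra of an $A$-bimodule. A representation $\sigma:\Pi^\lambda(A)\to\mathrm{End}(V)$ *extends* a representation $\varrho:A\to\mathrm{End}(V)$ if its composition with the canonical homomorphism $A\to\Pi^\lambda(A)$ is $\varrho$. For an $A$-bimodule $M$, $\mathrm{HH}_0(A,M)$ and $\mathrm{HH}_1(A,M)$ are the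 homology groups in degrees $0$ and $1$ of the Hochschild complex $\cdots\to M\otimes A\otimes A\to M\otimes A\to M$ with $b(m\otimes a)=ma-am$ and $b(m\otimes a\otimes a')=ma\otimes a'-m\otimes aa'+a'm\otimes a$. In particular $\mathrm{HH}_0(A):=\mathrm{HH}_0(A,A)=A/[A,A]$. **Theorem.** Let $A$ be a finitely generated quasi-free $\mathbb{C}$-algebra and let $\varrho:A\to\mathrm{End}(V)$ be a representation of $A$ on a complex vector space $V$, not necessarily finite-dimensional. Regard $\mathrm{End}(V)$ as an $A$-bimodule through $\varrho$. 1. For every $\lambda\in A$: $\varrho$ extends to a representation of $\Pi^\lambda(A)$ if and only if the class of $\varrho(\lambda)$ in $\mathrm{HH}_0(A,\mathrm{End}\,V)$ is zero; and if an extension exists, then it is unique if and only if $\mathrm{HH}_1(A,\mathrm{End}\,V)=0$. 2. The same holds for weights. Let $\mathrm{Tr}_A:\mathbb{C}\otimes_{\mathbb{Z}}K_0(A)\to\mathrm{HH}_0(A)$ be the linear map sending the class of a finitely generated projective right module $eA^n$, with $e$ an idempotent $n\times n$ matrix over $A$, to the class of the trace of $e$. Let $\boldsymbol\lambda\in\mathbb{C}\otimes_{\mathbb{Z}}K_0(A)$,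 let $\lambda\in A$ be any lifting of $\mathrm{Tr}_A(\boldsymbol\lambda)$, and put $\Pi^{\boldsymbol\lambda}(A):=\Pi^\lambda(A)$. Then $\varrho$ extends to a representation of $\Pi^{\boldsymbol\lambda}(A)$ if and only if the image of $\mathrm{Tr}_A(\boldsymbol\lambda)$ under the map $\mathrm{HH}_0(A)\to\mathrm{HH}_0(A,\mathrm{End}\,V)$ induced by $\varrho$ is zero; and if an extension exists, then it is unique if and only if $\mathrm{HH}_1(A,\mathrm{End}\,V)=0$. -/

import Mathlib

open scoped TensorProduct

set_option linter.unusedSectionVars false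

namespace DefPreproj

universe u v w

/-! ### Quasi-free algebras -/

/-- A unital associative `k`-algebra `A` is quasi-free (formally smooth in the category of all
unital associative algebras): every homomorphism from `A` to the target of a surjective algebra
homomorphism with square-zero kernel can be lifted along it. -/
def IsQuasiFree (k : Type w) [Field k] (A : Type u) [Ring A] [Algebra k A] : Prop :=
  ∀ (R S : Type u) [Ring R] [Algebra k R] [Ring S] [Algebra k S] (p : R →ₐ[k] S),
    Function.Surjective p → (∀ x y : R, p x = 0 → p y = 0 → x * y = 0) →
    ∀ f : A →ₐ[k] S, ∃ g : A →ₐ[k] R, p.comp g = f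

/-! ### Hochschild homology in degrees 0 and 1

The Hochschild complex of `A` with coefficients in an `A`-bimodule `M` is
`⋯ → M ⊗ A ⊗ A → M ⊗ A → M`. A bimodule is a left `A`-module and a left `Aᵐᵒᵖ`-module whose
actions commute and are compatible with scalars; `m b` is `MulOpposite.op b • m`. -/

section Hochschild

variable (k : Type w) [Field k] (A : Type u) [Ring A] [Algebra k A]
variable (M : Type v) [AddCommGroup M] [Module k M] [Module A M] [Module Aᵐᵒᵖ M]
  [IsScalarTower k A M] [IsScalarTower k Aᵐᵒᵖ M]

/-- The left action as a linear map `m ⊗ a ↦ a m`. -/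
noncomputable def leftAct : M ⊗[k] A →ₗ[k] M :=
  TensorProduct.lift (LinearMap.mk₂ k (fun (m : M) (a : A) => a • m)
    (fun m m' a => smul_add a m m') (fun c m a => smul_algebra_smul_comm c a m)
    (fun m a a' => add_smul a a' m) (fun c m a => smul_assoc c a m))

/-- The right action as a linear map `m ⊗ a ↦ m a`. -/
noncomputable def rightAct : M ⊗[k] A →ₗ[k] M :=
  TensorProduct.lift (LinearMap.mk₂ k (fun (m : M) (a : A) => MulOpposite.op a • m)
    (fun m m' a => smul_add _ m m')
    (fun c m a => smul_algebra_smul_comm c (MulOpposite.op a) m)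
    (fun m a a' => by rw [MulOpposite.op_add, add_smul])
    (fun c m a => by rw [MulOpposite.op_smul, smul_assoc]))

@[simp] theorem leftAct_tmul (m : M) (a : A) : leftAct k A M (m ⊗ₜ a) = a • m := rfl

@[simp] theorem rightAct_tmul (m : M) (a : A) :
    rightAct k A M (m ⊗ₜ a) = MulOpposite.op a • m := rfl

/-- The Hochschild differential `b(m ⊗ a) = m a - a m`. -/
noncomputable def hochB1 : M ⊗[k] A →ₗ[k] M := rightAct k A M - leftAct k A M

/-- The Hochschild differential `b(m ⊗ a ⊗ a') = m a ⊗ a' - m ⊗ a a' + a' m ⊗ a`. -/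
noncomputable def hochB2 : M ⊗[k] (A ⊗[k] A) →ₗ[k] M ⊗[k] A :=
  (rightAct k A M).rTensor A ∘ₗ (TensorProduct.assoc k M A A).symm.toLinearMap
  - (LinearMap.mul' k A).lTensor M
  + (leftAct k A M).rTensor A ∘ₗ (TensorProduct.assoc k M A A).symm.toLinearMap
      ∘ₗ (TensorProduct.comm k A A).toLinearMap.lTensor M

theorem hochB1_tmul (m : M) (a : A) :
    hochB1 k A M (m ⊗ₜ a) = MulOpposite.op a • m - a • m := rfl

theorem hochB2_tmul (m : M) (a a' : A) :
    hochB2 k A M (m ⊗ₜ (a ⊗ₜ a')) =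
      (MulOpposite.op a • m) ⊗ₜ a' - m ⊗ₜ (a * a') + (a' • m) ⊗ₜ a := by
  simp [hochB2]

/-- The two differentials compose to zero. -/
theorem hochB1_comp_hochB2 [SMulCommClass A Aᵐᵒᵖ M] :
    hochB1 k A M ∘ₗ hochB2 k A M = 0 := by
  apply TensorProduct.ext_threefold'
  intro m a a'
  simp only [LinearMap.comp_apply, hochB2_tmul, map_add, map_sub, hochB1_tmul,
    LinearMap.zero_apply, MulOpposite.op_mul, mul_smul, smul_comm a' (MulOpposite.op a) m]
  abel

/-- `HH₀(A, M) = M / [A, M]`. -/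
abbrev HH0 : Type v := M ⧸ LinearMap.range (hochB1 k A M)

/-- `HH₁(A, M)`: one-cycles modulo one-boundaries. -/
abbrev HH1 : Type _ :=
  LinearMap.ker (hochB1 k A M) ⧸
    (LinearMap.range (hochB2 k A M)).submoduleOf (LinearMap.ker (hochB1 k A M))

end Hochschild

/-! ### An algebra as a bimodule through a homomorphism -/

section ViaHom

variable {k : Type w} [Field k] {A : Type u} [Ring A] [Algebra k A]
  {B : Type v} [Ring B] [Algebra k B]

/-- `B` regarded as an `A`-bimodule through `ρ : A → B`, with `a · b · a' = ρ(a) b ρ(a')`. -/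
def ViaHom (_ρ : A →ₐ[k] B) : Type v := B

variable (ρ : A →ₐ[k] B)

instance : AddCommGroup (ViaHom ρ) := inferInstanceAs (AddCommGroup B)

instance : Module k (ViaHom ρ) := inferInstanceAs (Module k B)

/-- The identity map `B → B`, with target regarded as a bimodule. -/
def ViaHom.of : B ≃ₗ[k] ViaHom ρ := LinearEquiv.refl k B

instance : Module A (ViaHom ρ) := Module.compHom B ρ.toRingHom

instance : Module Aᵐᵒᵖ (ViaHom ρ) := Module.compHom B (AlgHom.op ρ).toRingHom

theorem ViaHom.smul_of (a : A) (b : B) : a • ViaHom.of ρ b = ViaHom.of ρ (ρ a * b) := rfl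

theorem ViaHom.op_smul_of (a : A) (b : B) :
    MulOpposite.op a • ViaHom.of ρ b = ViaHom.of ρ (b * ρ a) := rfl

instance : IsScalarTower k A (ViaHom ρ) where
  smul_assoc c a m := by
    obtain ⟨b, rfl⟩ := (ViaHom.of ρ).surjective m
    rw [ViaHom.smul_of, ViaHom.smul_of, ← map_smul, map_smul, smul_mul_assoc]

instance : IsScalarTower k Aᵐᵒᵖ (ViaHom ρ) where
  smul_assoc c a m := by
    obtain ⟨b, rfl⟩ := (ViaHom.of ρ).surjective m
    induction a using MulOpposite.rec' with
    | _ a => rw [← MulOpposite.op_smul, ViaHom.op_smul_of, ViaHom.op_smul_of, ← map_smul,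
        map_smul, mul_smul_comm]

instance : SMulCommClass A Aᵐᵒᵖ (ViaHom ρ) where
  smul_comm a a' m := by
    obtain ⟨b, rfl⟩ := (ViaHom.of ρ).surjective m
    induction a' using MulOpposite.rec' with
    | _ a' => simp only [ViaHom.op_smul_of, ViaHom.smul_of, mul_assoc]

/-- The linear map `HH₀(A) = A / [A, A] → HH₀(A, B)` induced by `ρ : A → B`, sending the class of
`a` to the class of `ρ(a)`. -/
noncomputable def HH0map : HH0 k A A →ₗ[k] HH0 k A (ViaHom ρ) :=
  Submodule.mapQ _ _ ((ViaHom.of ρ).toLinearMap ∘ₗ ρ.toLinearMap) (by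
    rintro _ ⟨t, rfl⟩
    refine ⟨((ViaHom.of ρ).toLinearMap ∘ₗ ρ.toLinearMap).rTensor A t, ?_⟩
    induction t with
    | zero => simp only [map_zero]
    | add x y hx hy => simp only [map_add, hx, hy]
    | tmul x y =>
      rw [LinearMap.rTensor_tmul]
      change hochB1 k A (ViaHom ρ) (ViaHom.of ρ (ρ x) ⊗ₜ y) = _
      rw [hochB1_tmul, hochB1_tmul, ViaHom.smul_of, ViaHom.op_smul_of, ← map_sub]
      simp)

end ViaHom

/-! ### Double derivations -/

section DoubleDer

variable (k : Type w) [Field k] (A : Type u) [Ring A] [Algebra k A]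

/-- The linear derivations `A → A ⊗ A` for the outer bimodule structure
`a (x ⊗ y) b = a x ⊗ y b`, as a subspace of all linear maps. -/
def doubleDerSubmodule : Submodule k (A →ₗ[k] A ⊗[k] A) where
  carrier := {d | ∀ a b : A, d (a * b) = (a ⊗ₜ[k] 1) * d b + d a * (1 ⊗ₜ[k] b)}
  zero_mem' := by intro a b; simp
  add_mem' := by
    intro d d' hd hd' a b
    simp only [LinearMap.add_apply, hd a b, hd' a b, mul_add, add_mul]
    abel
  smul_mem' := by
    intro c d hd a b
    simp only [LinearMap.smul_apply, hd a b, smul_add, mul_smul_comm, smul_mul_assoc]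

/-- `Der(A, A ⊗ A)`. -/
def DoubleDer : Type _ := doubleDerSubmodule k A

noncomputable instance : AddCommGroup (DoubleDer k A) :=
  inferInstanceAs (AddCommGroup (doubleDerSubmodule k A))

noncomputable instance : Module k (DoubleDer k A) :=
  inferInstanceAs (Module k (doubleDerSubmodule k A))

variable {k A}

/-- The linear map underlying a double derivation. -/
def DoubleDer.toLin : DoubleDer k A →ₗ[k] (A →ₗ[k] A ⊗[k] A) :=
  (doubleDerSubmodule k A).subtype

theorem DoubleDer.toLin_injective : Function.Injective (DoubleDer.toLin (k := k) (A := A)) :=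
  Subtype.val_injective

theorem DoubleDer.leibniz (d : DoubleDer k A) (a b : A) :
    d.toLin (a * b) = (a ⊗ₜ[k] 1) * d.toLin b + d.toLin a * (1 ⊗ₜ[k] b) := d.2 a b

theorem DoubleDer.ext {d d' : DoubleDer k A} (h : ∀ x, d.toLin x = d'.toLin x) : d = d' :=
  DoubleDer.toLin_injective (LinearMap.ext h)

/-- Left action on `Der(A, A ⊗ A)` from the inner structure: `a · (x ⊗ y) = x ⊗ a y`. -/
noncomputable def DoubleDer.leftMul (a : A) (d : DoubleDer k A) : DoubleDer k A :=
  ⟨LinearMap.mulLeft k ((1 : A) ⊗ₜ[k] a) ∘ₗ d.toLin, by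
    intro x y
    have h : ((1 : A) ⊗ₜ[k] a) * (x ⊗ₜ[k] 1) = (x ⊗ₜ[k] 1) * ((1 : A) ⊗ₜ[k] a) := by simp
    simp only [LinearMap.comp_apply, LinearMap.mulLeft_apply, d.leibniz x y, mul_add,
      ← mul_assoc, h]⟩

/-- Right action on `Der(A, A ⊗ A)` from the inner structure: `(x ⊗ y) · b = x b ⊗ y`. -/
noncomputable def DoubleDer.rightMul (b : A) (d : DoubleDer k A) : DoubleDer k A :=
  ⟨LinearMap.mulRight k (b ⊗ₜ[k] (1 : A)) ∘ₗ d.toLin, by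
    intro x y
    have h : ((1 : A) ⊗ₜ[k] y) * (b ⊗ₜ[k] 1) = (b ⊗ₜ[k] 1) * ((1 : A) ⊗ₜ[k] y) := by simp
    simp only [LinearMap.comp_apply, LinearMap.mulRight_apply, d.leibniz x y, add_mul,
      mul_assoc, h]⟩

noncomputable instance : SMul A (DoubleDer k A) := ⟨DoubleDer.leftMul⟩

noncomputable instance : SMul Aᵐᵒᵖ (DoubleDer k A) :=
  ⟨fun b d => DoubleDer.rightMul (MulOpposite.unop b) d⟩

theorem DoubleDer.smul_apply (a : A) (d : DoubleDer k A) (x : A) :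
    (a • d).toLin x = ((1 : A) ⊗ₜ[k] a) * d.toLin x := rfl

theorem DoubleDer.op_smul_apply (b : Aᵐᵒᵖ) (d : DoubleDer k A) (x : A) :
    (b • d).toLin x = d.toLin x * (MulOpposite.unop b ⊗ₜ[k] (1 : A)) := rfl

/-- The left `A`-module structure on `Der(A, A ⊗ A)` from the inner bimodule structure. -/
noncomputable instance : Module A (DoubleDer k A) where
  one_smul d := DoubleDer.ext fun x => by
    rw [DoubleDer.smul_apply, ← Algebra.TensorProduct.one_def, one_mul]
  mul_smul a b d := DoubleDer.ext fun x => by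
    simp only [DoubleDer.smul_apply, ← mul_assoc, Algebra.TensorProduct.tmul_mul_tmul, one_mul]
  smul_zero a := DoubleDer.ext fun x => by simp [DoubleDer.smul_apply]
  smul_add a d d' := DoubleDer.ext fun x => by simp [DoubleDer.smul_apply, mul_add]
  add_smul a b d := DoubleDer.ext fun x => by
    simp [DoubleDer.smul_apply, TensorProduct.tmul_add, add_mul]
  zero_smul d := DoubleDer.ext fun x => by simp [DoubleDer.smul_apply]

/-- The right `A`-module structure on `Der(A, A ⊗ A)` from the inner bimodule structure. -/
noncomputable instance : Module Aᵐᵒᵖ (DoubleDer k A) where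
  one_smul d := DoubleDer.ext fun x => by
    rw [DoubleDer.op_smul_apply, MulOpposite.unop_one, ← Algebra.TensorProduct.one_def, mul_one]
  mul_smul a b d := DoubleDer.ext fun x => by
    simp only [DoubleDer.op_smul_apply, mul_assoc, Algebra.TensorProduct.tmul_mul_tmul, one_mul,
      MulOpposite.unop_mul]
  smul_zero a := DoubleDer.ext fun x => by simp [DoubleDer.op_smul_apply]
  smul_add a d d' := DoubleDer.ext fun x => by simp [DoubleDer.op_smul_apply, add_mul]
  add_smul a b d := DoubleDer.ext fun x => by
    simp [DoubleDer.op_smul_apply, TensorProduct.add_tmul, mul_add]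
  zero_smul d := DoubleDer.ext fun x => by simp [DoubleDer.op_smul_apply]

variable (k A)

/-- The canonical double derivation `Δ(x) = x ⊗ 1 - 1 ⊗ x`. -/
noncomputable def Delta : DoubleDer k A :=
  ⟨(TensorProduct.mk k A A).flip 1 - TensorProduct.mk k A A 1, by
    intro x y
    simp [mul_sub, sub_mul]⟩

theorem Delta_apply (x : A) : (Delta k A).toLin x = x ⊗ₜ[k] 1 - 1 ⊗ₜ[k] x := rfl

end DoubleDer

/-! ### The tensor algebra of a bimodule -/

section TensorAlg

variable (k : Type w) [Field k] (A : Type u) [Ring A] [Algebra k A]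
variable (M : Type v) [AddCommGroup M] [Module k M] [Module A M] [Module Aᵐᵒᵖ M]

/-- The relations imposed on the free `k`-algebra on the vector space `A × M` to obtain `T_A M`:
the map from `A` is a homomorphism of unital algebras and the map from `M` is a homomorphism of
`A`-bimodules (both are `k`-linear already). -/
inductive BimodTensorRel : TensorAlgebra k (A × M) → TensorAlgebra k (A × M) → Prop
  | one : BimodTensorRel (TensorAlgebra.ι k (1, 0)) 1
  | mul (a b : A) : BimodTensorRel (TensorAlgebra.ι k (a * b, 0))
      (TensorAlgebra.ι k (a, 0) * TensorAlgebra.ι k (b, 0))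
  | left (a : A) (m : M) : BimodTensorRel (TensorAlgebra.ι k (0, a • m))
      (TensorAlgebra.ι k (a, 0) * TensorAlgebra.ι k (0, m))
  | right (m : M) (b : A) : BimodTensorRel (TensorAlgebra.ι k (0, MulOpposite.op b • m))
      (TensorAlgebra.ι k (0, m) * TensorAlgebra.ι k (b, 0))

/-- The tensor algebra `T_A M` of an `A`-bimodule `M`: the universal `k`-algebra with an algebra
homomorphism from `A` and an `A`-bimodule map from `M` (see `liftEquiv` below). -/
abbrev BimodTensorAlgebra : Type _ := RingQuot (BimodTensorRel k A M)

namespace BimodTensorAlgebra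

/-- The canonical homomorphism `A → T_A M`. -/
noncomputable def ofAlg : A →ₐ[k] BimodTensorAlgebra k A M :=
  AlgHom.ofLinearMap
    ((RingQuot.mkAlgHom k (BimodTensorRel k A M)).toLinearMap ∘ₗ TensorAlgebra.ι k
      ∘ₗ LinearMap.inl k A M)
    (by simpa using RingQuot.mkAlgHom_rel k (BimodTensorRel.one (k := k) (A := A) (M := M)))
    (fun a b => by
      simpa using RingQuot.mkAlgHom_rel k (BimodTensorRel.mul (k := k) (M := M) a b))

/-- The canonical bimodule map `M → T_A M`. -/
noncomputable def ofMod : M →ₗ[k] BimodTensorAlgebra k A M :=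
  (RingQuot.mkAlgHom k (BimodTensorRel k A M)).toLinearMap ∘ₗ TensorAlgebra.ι k
    ∘ₗ LinearMap.inr k A M

theorem ofMod_smul (a : A) (m : M) :
    ofMod k A M (a • m) = ofAlg k A M a * ofMod k A M m := by
  simpa [ofMod, ofAlg] using RingQuot.mkAlgHom_rel k (BimodTensorRel.left (k := k) a m)

theorem ofMod_op_smul (m : M) (b : A) :
    ofMod k A M (MulOpposite.op b • m) = ofMod k A M m * ofAlg k A M b := by
  simpa [ofMod, ofAlg] using RingQuot.mkAlgHom_rel k (BimodTensorRel.right (k := k) m b)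

variable {k A M}
variable {B : Type*} [Ring B] [Algebra k B]

theorem hom_ext {F G : BimodTensorAlgebra k A M →ₐ[k] B}
    (h₁ : ∀ a, F (ofAlg k A M a) = G (ofAlg k A M a))
    (h₂ : ∀ m, F (ofMod k A M m) = G (ofMod k A M m)) : F = G := by
  apply RingQuot.ringQuot_ext'
  apply TensorAlgebra.hom_ext
  apply LinearMap.prod_ext
  · exact LinearMap.ext h₁
  · exact LinearMap.ext h₂

/-- The homomorphism out of `T_A M` given by compatible maps on `A` and `M`. -/
noncomputable def lift (f : A →ₐ[k] B) (g : M →ₗ[k] B)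
    (hl : ∀ (a : A) (m : M), g (a • m) = f a * g m)
    (hr : ∀ (m : M) (b : A), g (MulOpposite.op b • m) = g m * f b) :
    BimodTensorAlgebra k A M →ₐ[k] B :=
  RingQuot.liftAlgHom k ⟨TensorAlgebra.lift k (LinearMap.coprod f.toLinearMap g), by
    intro x y h
    cases h <;> simp [hl, hr]⟩

theorem lift_ofAlg (f : A →ₐ[k] B) (g : M →ₗ[k] B)
    (hl : ∀ (a : A) (m : M), g (a • m) = f a * g m)
    (hr : ∀ (m : M) (b : A), g (MulOpposite.op b • m) = g m * f b) (a : A) :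
    lift f g hl hr (ofAlg k A M a) = f a := by
  simp [lift, ofAlg]

theorem lift_ofMod (f : A →ₐ[k] B) (g : M →ₗ[k] B)
    (hl : ∀ (a : A) (m : M), g (a • m) = f a * g m)
    (hr : ∀ (m : M) (b : A), g (MulOpposite.op b • m) = g m * f b) (m : M) :
    lift f g hl hr (ofMod k A M m) = g m := by
  simp [lift, ofMod]

/-- The universal property of `T_A M`. -/
noncomputable def liftEquiv :
    {p : (A →ₐ[k] B) × (M →ₗ[k] B) //
      (∀ (a : A) (m : M), p.2 (a • m) = p.1 a * p.2 m) ∧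
      ∀ (m : M) (b : A), p.2 (MulOpposite.op b • m) = p.2 m * p.1 b} ≃
    (BimodTensorAlgebra k A M →ₐ[k] B) where
  toFun p := lift p.1.1 p.1.2 p.2.1 p.2.2
  invFun F := ⟨(F.comp (ofAlg k A M), F.toLinearMap ∘ₗ ofMod k A M),
    fun a m => by simp [ofMod_smul], fun m b => by simp [ofMod_op_smul]⟩
  left_inv p := by
    apply Subtype.ext
    apply Prod.ext
    · exact AlgHom.ext fun a => lift_ofAlg _ _ p.2.1 p.2.2 a
    · exact LinearMap.ext fun m => lift_ofMod _ _ p.2.1 p.2.2 m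
  right_inv F := hom_ext (fun a => lift_ofAlg _ _ _ _ a) (fun m => lift_ofMod _ _ _ _ m)

end BimodTensorAlgebra

end TensorAlg

/-! ### Deformed preprojective algebras -/

section Preproj

variable (k : Type w) [Field k] {A : Type u} [Ring A] [Algebra k A]

/-- The two-sided ideal `⟨Δ - lam⟩` of `T_A Der(A, A ⊗ A)`. -/
noncomputable def preprojIdeal (lam : A) :
    TwoSidedIdeal (BimodTensorAlgebra k A (DoubleDer k A)) :=
  TwoSidedIdeal.span {BimodTensorAlgebra.ofMod k A (DoubleDer k A) (Delta k A)
    - BimodTensorAlgebra.ofAlg k A (DoubleDer k A) lam}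

/-- `Π^lam(A) = T_A Der(A, A ⊗ A) / ⟨Δ - lam⟩`. -/
abbrev Preproj (lam : A) : Type _ := (preprojIdeal k lam).ringCon.Quotient

/-- The quotient homomorphism `T_A Der(A, A ⊗ A) → Π^lam(A)`. -/
noncomputable def Preproj.mk (lam : A) :
    BimodTensorAlgebra k A (DoubleDer k A) →ₐ[k] Preproj k lam :=
  { (preprojIdeal k lam).ringCon.mk' with commutes' := fun _ => rfl }

/-- The canonical homomorphism `A → Π^lam(A)`. -/
noncomputable def Preproj.ofAlg (lam : A) : A →ₐ[k] Preproj k lam :=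
  (Preproj.mk k lam).comp (BimodTensorAlgebra.ofAlg k A (DoubleDer k A))

variable {k}

/-- `σ : Π^lam(A) → B` extends `ρ : A → B`: it restricts to `ρ` along `A → Π^lam(A)`. -/
def Extends {lam : A} {B : Type v} [Ring B] [Algebra k B] (σ : Preproj k lam →ₐ[k] B)
    (ρ : A →ₐ[k] B) : Prop :=
  σ.comp (Preproj.ofAlg k lam) = ρ

end Preproj

/-! ### The group `K₀`, weights and the trace map -/

section KTheory

/-- An idempotent matrix over `A`; it presents the finitely generated projective right module
`e Aⁿ`, and every such module is of this form. -/
structure IdemMat (A : Type u) [Ring A] where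
  /-- the size -/
  n : ℕ
  /-- the matrix -/
  e : Matrix (Fin n) (Fin n) A
  idem : e * e = e

variable (A : Type u) [Ring A]

/-- `r Aⁿ ≅ p Aˡ ⊕ q Aᵐ` as right modules, in terms of idempotent matrices: there are rectangular
matrices with `x y = p ⊕ q` and `y x = r`. -/
def IdemMat.IsSum {A : Type u} [Ring A] (p q r : IdemMat A) : Prop :=
  ∃ (x : Matrix (Fin p.n ⊕ Fin q.n) (Fin r.n) A) (y : Matrix (Fin r.n) (Fin p.n ⊕ Fin q.n) A),
    x * y = Matrix.fromBlocks p.e 0 0 q.e ∧ y * x = r.e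

/-- The relations `[P ⊕ Q] = [P] + [Q]`, as a subgroup of the free abelian group. -/
def K0rel : AddSubgroup (FreeAbelianGroup (IdemMat A)) :=
  AddSubgroup.closure {z | ∃ p q r : IdemMat A, IdemMat.IsSum p q r ∧
    z = FreeAbelianGroup.of r - (FreeAbelianGroup.of p + FreeAbelianGroup.of q)}

/-- `K₀(A)`: generators are finitely generated projective modules `P`, with a relation
`[R] = [P] + [Q]` whenever `R ≅ P ⊕ Q`. -/
abbrev K0 : Type u := FreeAbelianGroup (IdemMat A) ⧸ K0rel A

variable (k : Type w) [Field k] [Algebra k A]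

/-- The class of the trace of an idempotent matrix in `HH₀(A) = A / [A, A]`. -/
noncomputable def traceClass (p : IdemMat A) : HH0 k A A :=
  Submodule.Quotient.mk p.e.trace

theorem HH0_mk_mul_comm (a b : A) :
    (Submodule.Quotient.mk (a * b) : HH0 k A A) = Submodule.Quotient.mk (b * a) := by
  rw [Submodule.Quotient.eq]
  exact ⟨a ⊗ₜ b, by rw [hochB1_tmul]; simp⟩

theorem HH0_mk_trace_mul_comm {m n : Type*} [Fintype m] [Fintype n] (x : Matrix m n A)
    (y : Matrix n m A) :
    (Submodule.Quotient.mk (x * y).trace : HH0 k A A) = Submodule.Quotient.mk (y * x).trace := by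
  simp only [← Submodule.mkQ_apply, Matrix.trace, Matrix.diag_apply, Matrix.mul_apply, map_sum]
  rw [Finset.sum_comm]
  refine Finset.sum_congr rfl fun j _ => Finset.sum_congr rfl fun i _ => ?_
  exact HH0_mk_mul_comm A k (x i j) (y j i)

/-- The trace map `Tr_A : K₀(A) → HH₀(A)`, sending the class of `e Aⁿ` to the class of the trace
of `e`. -/
noncomputable def traceK0 : K0 A →+ HH0 k A A :=
  QuotientAddGroup.lift (K0rel A) (FreeAbelianGroup.lift (traceClass A k)) (by
    rw [K0rel, AddSubgroup.closure_le]
    rintro _ ⟨p, q, r, ⟨x, y, hxy, hyx⟩, rfl⟩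
    have h := HH0_mk_trace_mul_comm A k x y
    have ht : (Matrix.fromBlocks p.e 0 0 q.e).trace = p.e.trace + q.e.trace := by
      simp [Matrix.trace]
    rw [hxy, hyx, ht, Submodule.Quotient.mk_add] at h
    simp only [SetLike.mem_coe, AddMonoidHom.mem_ker, map_sub, map_add,
      FreeAbelianGroup.lift_apply_of, traceClass]
    rw [← h, sub_self])

/-- Weights: elements of `k ⊗_ℤ K₀(A)`. -/
abbrev Weight : Type _ := k ⊗[ℤ] K0 A

/-- The linear extension `Tr_A : k ⊗_ℤ K₀(A) → HH₀(A)`. -/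
noncomputable def traceWeight : Weight A k →ₗ[k] HH0 k A A :=
  LinearMap.liftBaseChange k (traceK0 A k).toIntLinearMap

end KTheory

end DefPreproj

namespace DefPreproj

universe u v w

/-! ### Bimodule actions of `A ⊗ A` -/

section Actions

variable (k : Type w) [Field k] (A : Type u) [Ring A] [Algebra k A]

/-! Put `M = End V`. By the universal properties of `T_A` and of the quotient, extensions of `ρ` to
`Π^λ(A)` are the same as bimodule maps `g : Der(A, A ⊗ A) → M` with `g(Δ) = ρ(λ)`
(`exists_extends_of_bimoduleMap`, `Extends.ext_extensionMap`). So everything rests on knowing these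
bimodule maps and their values at `Δ`.

For finitely generated quasi-free `A` the bimodule `Ω¹A`, the sub-bimodule of `A ⊗ A` generated by
all `Δ(a)`, is finitely generated projective, here in the form of a finite dual basis
(`exists_isDualBasis`). Since `Der(A, A ⊗ A)` is its bimodule dual, each bimodule map into `M` comes
from `M ⊗_{Aᵉ} Ω¹A`, which is `M ⊗ A` modulo Hochschild boundaries. Concretely, `contract` is onto
the bimodule maps (`IsDualBasis.exists_contract_eq`) with kernel the boundaries
(`IsDualBasis.contract_eq_zero_iff`).

Under this identification evaluation at `Δ` is the Hochschild differential `b` (`contract_Delta`).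
Hence `ρ(λ)` is a possible value iff it lies in the image of `b`, and the solutions then form a
torsor under `ker b` modulo boundaries, which is `HH₁`. Weights enter only through the class of `λ`,
so the second part reduces to the first. -/

/-- The action of `A ⊗ A` on itself from the outer structure: `p ⊗ q` sends `w` to
`(p ⊗ 1) w (1 ⊗ q)`. -/
noncomputable def outerAct : A ⊗[k] A →ₗ[k] A ⊗[k] A →ₗ[k] A ⊗[k] A :=
  TensorProduct.lift (LinearMap.mk₂ k
    (fun p q => LinearMap.mulLeft k (p ⊗ₜ[k] (1 : A)) ∘ₗ LinearMap.mulRight k ((1 : A) ⊗ₜ[k] q))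
    (fun p p' q => LinearMap.ext fun w => by simp [TensorProduct.add_tmul, add_mul])
    (fun c p q => LinearMap.ext fun w => by simp [← TensorProduct.smul_tmul'])
    (fun p q q' => LinearMap.ext fun w => by simp [TensorProduct.tmul_add, mul_add])
    (fun c p q => LinearMap.ext fun w => by simp))

@[simp] theorem outerAct_tmul (p q : A) (w : A ⊗[k] A) :
    outerAct k A (p ⊗ₜ q) w = (p ⊗ₜ[k] 1) * (w * (1 ⊗ₜ[k] q)) := rfl

theorem outerAct_one (w : A ⊗[k] A) : outerAct k A 1 w = w := by
  rw [Algebra.TensorProduct.one_def, outerAct_tmul, ← Algebra.TensorProduct.one_def, one_mul,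
    mul_one]

/-- With `outerAct_mul_right`, this is what closes the dual basis condition under products: the
corner entry of a product of triangular matrices is `(a ⊗ 1) t + s (1 ⊗ b)`. -/
theorem outerAct_left_mul (a : A) (t w : A ⊗[k] A) :
    outerAct k A ((a ⊗ₜ[k] 1) * t) w = (a ⊗ₜ[k] 1) * outerAct k A t w := by
  induction t with
  | zero => simp
  | add x y hx hy => simp only [mul_add, map_add, LinearMap.add_apply, hx, hy]
  | tmul p q => simp [← mul_assoc]

theorem outerAct_mul_right (b : A) (t w : A ⊗[k] A) :
    outerAct k A (t * (1 ⊗ₜ[k] b)) w = outerAct k A t w * (1 ⊗ₜ[k] b) := by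
  induction t with
  | zero => simp
  | add x y hx hy => simp only [add_mul, map_add, LinearMap.add_apply, hx, hy]
  | tmul p q => simp [mul_assoc]

variable (M : Type v) [AddCommGroup M] [Module k M] [Module A M] [Module Aᵐᵒᵖ M]
  [IsScalarTower k A M] [IsScalarTower k Aᵐᵒᵖ M]

/-- The action of `A ⊗ A` on a bimodule for which `p ⊗ q` sends `m` to `q m p`. -/
noncomputable def innerAct : A ⊗[k] A →ₗ[k] M →ₗ[k] M :=
  TensorProduct.lift (LinearMap.mk₂ k
    (fun p q => Algebra.lsmul k k M q ∘ₗ Algebra.lsmul k k M (MulOpposite.op p))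
    (fun p p' q => LinearMap.ext fun m => by simp)
    (fun c p q => LinearMap.ext fun m => by
      simp [smul_algebra_smul_comm])
    (fun p q q' => LinearMap.ext fun m => by simp)
    (fun c p q => LinearMap.ext fun m => by simp))

@[simp] theorem innerAct_tmul (p q : A) (m : M) :
    innerAct k A M (p ⊗ₜ q) m = q • MulOpposite.op p • m := rfl

variable {M}

/-- In `q m p` the inner multiplications of `p ⊗ q` land on the outside, so they become the actions
on the result. -/
theorem innerAct_smul_left (a : A) (t : A ⊗[k] A) (m : M) :
    innerAct k A M ((1 ⊗ₜ[k] a) * t) m = a • innerAct k A M t m := by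
  induction t with
  | zero => simp
  | add x y hx hy => simp only [mul_add, map_add, LinearMap.add_apply, hx, hy, smul_add]
  | tmul p q => simp [mul_smul]

theorem innerAct_smul_right [SMulCommClass A Aᵐᵒᵖ M] (b : A) (t : A ⊗[k] A) (m : M) :
    innerAct k A M (t * (b ⊗ₜ[k] 1)) m = MulOpposite.op b • innerAct k A M t m := by
  induction t with
  | zero => simp
  | add x y hx hy => simp only [add_mul, map_add, LinearMap.add_apply, hx, hy, smul_add]
  | tmul p q => simp [mul_smul, smul_comm q (MulOpposite.op b)]

/-- In `q m p` the outer multiplications of `p ⊗ q` land next to `m`, so they are absorbed into the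
argument. -/
theorem innerAct_left_mul (a : A) (t : A ⊗[k] A) (m : M) :
    innerAct k A M ((a ⊗ₜ[k] 1) * t) m = innerAct k A M t (MulOpposite.op a • m) := by
  induction t with
  | zero => simp
  | add x y hx hy => simp only [mul_add, map_add, LinearMap.add_apply, hx, hy]
  | tmul p q => simp [mul_smul]

theorem innerAct_mul_right [SMulCommClass A Aᵐᵒᵖ M] (b : A) (t : A ⊗[k] A) (m : M) :
    innerAct k A M (t * (1 ⊗ₜ[k] b)) m = innerAct k A M t (b • m) := by
  induction t with
  | zero => simp
  | add x y hx hy => simp only [add_mul, map_add, LinearMap.add_apply, hx, hy]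
  | tmul p q => simp [mul_smul, smul_comm b (MulOpposite.op p)]

end Actions

/-! ### Dual bases of the bimodule of differentials -/

section DualBasis

variable {k : Type w} [Field k] {A : Type u} [Ring A] [Algebra k A]

theorem DoubleDer.toLin_one (d : DoubleDer k A) : d.toLin 1 = 0 := by
  have h := d.leibniz 1 1
  rw [mul_one, ← Algebra.TensorProduct.one_def, one_mul, mul_one] at h
  exact left_eq_add.mp h

theorem DoubleDer.smul_toLin (c : k) (d : DoubleDer k A) (x : A) :
    (c • d).toLin x = c • d.toLin x := rfl

instance : IsScalarTower k A (DoubleDer k A) where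
  smul_assoc c a d := DoubleDer.ext fun x => by
    simp only [DoubleDer.smul_apply, DoubleDer.smul_toLin, TensorProduct.tmul_smul,
      smul_mul_assoc]

instance : IsScalarTower k Aᵐᵒᵖ (DoubleDer k A) where
  smul_assoc c a d := DoubleDer.ext fun x => by
    simp only [DoubleDer.op_smul_apply, DoubleDer.smul_toLin, MulOpposite.unop_smul,
      ← TensorProduct.smul_tmul', mul_smul_comm]

/-- If `d(a) = x ⊗ y` and `t = p ⊗ q`, both sides are `xp ⊗ qy`: inserting `t` inside `d(a)` is the
same as wrapping `d(a)` around `t`. -/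
theorem innerAct_toLin (t : A ⊗[k] A) (d : DoubleDer k A) (a : A) :
    (innerAct k A (DoubleDer k A) t d).toLin a = outerAct k A (d.toLin a) t := by
  -- The value `d(a)` need not be a pure tensor; as a free variable it can be decomposed by a second
  -- induction.
  generalize hs : d.toLin a = s
  induction t with
  | zero => simp
  | add x y hx hy => simp only [map_add, LinearMap.add_apply, hx, hy]
  | tmul p q =>
    rw [innerAct_tmul, DoubleDer.smul_apply, DoubleDer.op_smul_apply, hs]
    clear hs
    induction s with
    | zero => simp
    | add x y hx hy => simp only [map_add, LinearMap.add_apply, add_mul, mul_add, hx, hy]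
    | tmul x y => simp

/-- Elements `x i` and double derivations `d i` form a dual basis of the bimodule `Ω¹ A` of
noncommutative differentials if `Δ(a) = ∑ dᵢ(a)' Δ(xᵢ) dᵢ(a)''` for every `a`. -/
def IsDualBasis {ι : Type*} [Fintype ι] (x : ι → A) (d : ι → DoubleDer k A) : Prop :=
  ∀ a, (Delta k A).toLin a = ∑ i, outerAct k A ((d i).toLin a) ((Delta k A).toLin (x i))

variable (k) in
/-- The algebra of elements `a` of `A` together with matrices `(a ⊗ 1, tᵢ; 0, 1 ⊗ a)` over `A ⊗ A`
such that `Δ(a) = ∑ tᵢ' Δ(xᵢ) tᵢ''`. -/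
noncomputable def triangularSubalgebra {ι : Type*} [Fintype ι] (x : ι → A) :
    Subalgebra k (A × (ι → Matrix (Fin 2) (Fin 2) (A ⊗[k] A))) where
  carrier := {r | (∀ i, r.2 i 0 0 = r.1 ⊗ₜ 1 ∧ r.2 i 1 1 = 1 ⊗ₜ r.1 ∧ r.2 i 1 0 = 0) ∧
    (Delta k A).toLin r.1 = ∑ i, outerAct k A (r.2 i 0 1) ((Delta k A).toLin (x i))}
  mul_mem' := by
    rintro r s ⟨hr, hr'⟩ ⟨hs, hs'⟩
    refine ⟨fun i => ?_, ?_⟩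
    · obtain ⟨h₁, h₂, h₃⟩ := hr i
      obtain ⟨h₄, h₅, h₆⟩ := hs i
      simp [Matrix.mul_apply, Fin.sum_univ_two, h₁, h₂, h₃, h₄, h₅, h₆]
    -- The Leibniz rule for `Δ` has the same shape as the corner entry of the matrix product.
    · rw [Prod.fst_mul, DoubleDer.leibniz, hr', hs', Finset.mul_sum, Finset.sum_mul,
        ← Finset.sum_add_distrib]
      refine Finset.sum_congr rfl fun i _ => ?_
      rw [Prod.snd_mul, Pi.mul_apply, Matrix.mul_apply, Fin.sum_univ_two, (hr i).1, (hs i).2.1,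
        map_add, LinearMap.add_apply, outerAct_left_mul, outerAct_mul_right]
  add_mem' := by
    rintro r s ⟨hr, hr'⟩ ⟨hs, hs'⟩
    refine ⟨fun i => ?_, ?_⟩
    · obtain ⟨h₁, h₂, h₃⟩ := hr i
      obtain ⟨h₄, h₅, h₆⟩ := hs i
      simp [h₁, h₂, h₃, h₄, h₅, h₆, TensorProduct.add_tmul, TensorProduct.tmul_add]
    · simp [hr', hs', Finset.sum_add_distrib]
  algebraMap_mem' := by
    intro c
    refine ⟨fun i => ?_, ?_⟩
    · simp [Algebra.algebraMap_eq_smul_one, ← TensorProduct.smul_tmul',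
        Algebra.TensorProduct.one_def]
    · simp [Algebra.algebraMap_eq_smul_one, DoubleDer.toLin_one]

/-- A finitely generated quasi-free algebra has a dual basis: its bimodule of differentials is
finitely generated projective. -/
theorem exists_isDualBasis [Algebra.FiniteType k A] (hA : IsQuasiFree k A) :
    ∃ (s : Finset A) (d : s → DoubleDer k A), IsDualBasis (fun i : s => (i : A)) d := by
  classical
  obtain ⟨s, hs⟩ := (inferInstance : Algebra.FiniteType k A).out
  set R := triangularSubalgebra k (fun i : s => (i : A))
  let p : R →ₐ[k] A := (AlgHom.fst k A _).comp R.val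
  have hp : Function.Surjective p := by
    rw [← AlgHom.range_eq_top, eq_top_iff, ← hs, Algebra.adjoin_le_iff]
    intro y hy
    -- The generator `xⱼ` lifts with corner entries `tᵢ = δᵢⱼ`, for which the defining condition is
    -- trivial.
    refine ⟨⟨(y, fun i => !![y ⊗ₜ 1, if i = ⟨y, hy⟩ then 1 else 0; 0, 1 ⊗ₜ y]), ?_, ?_⟩, rfl⟩
    · intro i
      simp
    · rw [Finset.sum_eq_single (⟨y, hy⟩ : s)]
      · simp [outerAct_one]
      · intro i _ hi
        simp [hi]
      · simp
  -- Over `0` the diagonals vanish, and strictly upper triangular 2×2 matrices multiply to zero.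
  have hsq : ∀ x y : R, p x = 0 → p y = 0 → x * y = 0 := by
    rintro ⟨⟨x, f⟩, hx, -⟩ ⟨⟨y, g⟩, hy, -⟩ (rfl : x = 0) (rfl : y = 0)
    apply Subtype.ext
    refine Prod.ext (mul_zero _) (funext fun i => Matrix.ext fun a b => ?_)
    obtain ⟨h₁, h₂, h₃⟩ := hx i
    obtain ⟨h₄, h₅, h₆⟩ := hy i
    simp only [TensorProduct.zero_tmul, TensorProduct.tmul_zero] at h₁ h₂ h₃ h₄ h₅ h₆
    fin_cases a <;> fin_cases b <;>
      simp [Matrix.mul_apply, Fin.sum_univ_two, h₁, h₂, h₃, h₄, h₅, h₆]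
  -- Lifting the identity splits `p`. Multiplicativity of the section makes its corner entries
  -- double derivations, and membership in `R` is the dual basis identity.
  obtain ⟨g, hg⟩ := hA R A p hp hsq (AlgHom.id k A)
  have hg' : ∀ a, (g a).1.1 = a := fun a => DFunLike.congr_fun hg a
  refine ⟨s, fun i => ⟨{ toFun := fun a => (g a).1.2 i 0 1
                         map_add' := fun a b => by simp
                         map_smul' := fun c a => by simp }, fun a b => ?_⟩, fun a => ?_⟩
  · have ha := ((g a).2.1 i).1
    have hb := ((g b).2.1 i).2.1
    rw [hg'] at ha hb
    simp [Matrix.mul_apply, Fin.sum_univ_two, ha, hb]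
  · have h := (g a).2.2
    rwa [hg'] at h

end DualBasis

/-! ### Bimodule maps out of the double derivations -/

section Duality

variable {k : Type w} [Field k] {A : Type u} [Ring A] [Algebra k A]

/-- The dual basis formula `D(a) = ∑ dᵢ(a)' D(xᵢ) dᵢ(a)''` for a double derivation `D`. -/
theorem IsDualBasis.toLin_eq {ι : Type*} [Fintype ι] {x : ι → A} {d : ι → DoubleDer k A}
    (h : IsDualBasis x d) (D : DoubleDer k A) (a : A) :
    D.toLin a = ∑ i, outerAct k A ((d i).toLin a) (D.toLin (x i)) := by
  -- `θ(p ⊗ q) = p D(q)` is only left linear, but `p Δ(y) q = py ⊗ q - p ⊗ yq` goes to `-p D(y) q`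
  -- by Leibniz. Thus on `Ω¹A` it is minus the bimodule map induced by `D`, and can be applied to
  -- the formula for `Δ(a)`.
  let θ : A ⊗[k] A →ₗ[k] A ⊗[k] A :=
    TensorProduct.lift (LinearMap.mk₂ k (fun p q => (p ⊗ₜ[k] 1) * D.toLin q)
      (fun p p' q => by rw [TensorProduct.add_tmul, add_mul])
      (fun c p q => by rw [← TensorProduct.smul_tmul', smul_mul_assoc])
      (fun p q q' => by rw [map_add, mul_add])
      (fun c p q => by rw [map_smul, mul_smul_comm]))
  have hθ : ∀ p q, θ (p ⊗ₜ q) = (p ⊗ₜ[k] 1) * D.toLin q := fun _ _ => rfl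
  have hΔ : ∀ t y, θ (outerAct k A t ((Delta k A).toLin y)) = -outerAct k A t (D.toLin y) := by
    intro t y
    induction t with
    | zero => simp
    | add s t hs ht => simp only [map_add, LinearMap.add_apply, hs, ht, neg_add]
    | tmul p q =>
      simp only [outerAct_tmul, Delta_apply,
        Algebra.TensorProduct.tmul_mul_tmul, one_mul, mul_one, map_sub, hθ, D.leibniz, mul_add,
        ← mul_assoc]
      abel
  have h₁ := hΔ 1 a
  rw [outerAct_one, outerAct_one, h a, map_sum] at h₁
  rw [← neg_inj, ← h₁, ← Finset.sum_neg_distrib]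
  exact Finset.sum_congr rfl fun i _ => hΔ _ _

/-- The dual basis formula `D = ∑ D(xᵢ)'' dᵢ D(xᵢ)'` for a double derivation `D`. -/
theorem IsDualBasis.eq_sum {ι : Type*} [Fintype ι] {x : ι → A} {d : ι → DoubleDer k A}
    (h : IsDualBasis x d) (D : DoubleDer k A) :
    D = ∑ i, innerAct k A (DoubleDer k A) (D.toLin (x i)) (d i) :=
  DoubleDer.ext fun a => by
    rw [h.toLin_eq D a, map_sum, LinearMap.sum_apply]
    exact Finset.sum_congr rfl fun i _ => (innerAct_toLin _ _ _).symm

variable {M : Type v} [AddCommGroup M] [Module k M] [Module A M] [Module Aᵐᵒᵖ M]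
  [IsScalarTower k A M] [IsScalarTower k Aᵐᵒᵖ M]

theorem map_innerAct {N : Type*} [AddCommGroup N] [Module k N] [Module A N] [Module Aᵐᵒᵖ N]
    [IsScalarTower k A N] [IsScalarTower k Aᵐᵒᵖ N] (g : N →ₗ[k] M)
    (hl : ∀ (a : A) n, g (a • n) = a • g n)
    (hr : ∀ n (b : A), g (MulOpposite.op b • n) = MulOpposite.op b • g n)
    (t : A ⊗[k] A) (n : N) : g (innerAct k A N t n) = innerAct k A M t (g n) := by
  induction t with
  | zero => simp
  | add x y hx hy => simp only [map_add, LinearMap.add_apply, hx, hy]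
  | tmul p q => simp [hl, hr]

variable (k A M)

/-- The map `M ⊗ A → Hom(Der(A, A ⊗ A), M)` sending `m ⊗ a` to `d ↦ d(a)'' m d(a)'`. -/
noncomputable def contract : M ⊗[k] A →ₗ[k] DoubleDer k A →ₗ[k] M :=
  TensorProduct.lift (LinearMap.mk₂ k
    (fun m a => (innerAct k A M).flip m ∘ₗ DoubleDer.toLin.flip a)
    (fun m m' a => LinearMap.ext fun d => by simp)
    (fun c m a => LinearMap.ext fun d => by simp)
    (fun m a a' => LinearMap.ext fun d => by simp)
    (fun c m a => LinearMap.ext fun d => by simp))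

theorem contract_tmul (m : M) (a : A) (d : DoubleDer k A) :
    contract k A M (m ⊗ₜ a) d = innerAct k A M (d.toLin a) m := rfl

variable {k A M}

theorem contract_smul (t : M ⊗[k] A) (a : A) (d : DoubleDer k A) :
    contract k A M t (a • d) = a • contract k A M t d := by
  induction t with
  | zero => simp
  | add x y hx hy => simp only [map_add, LinearMap.add_apply, hx, hy, smul_add]
  | tmul m b => rw [contract_tmul, contract_tmul, DoubleDer.smul_apply, innerAct_smul_left]

theorem contract_op_smul [SMulCommClass A Aᵐᵒᵖ M] (t : M ⊗[k] A) (d : DoubleDer k A) (b : A) :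
    contract k A M t (MulOpposite.op b • d) = MulOpposite.op b • contract k A M t d := by
  induction t with
  | zero => simp
  | add x y hx hy => simp only [map_add, LinearMap.add_apply, hx, hy, smul_add]
  | tmul m a =>
    rw [contract_tmul, contract_tmul, DoubleDer.op_smul_apply, MulOpposite.unop_op,
      innerAct_smul_right]

/-- Since `Δ(a) = a ⊗ 1 - 1 ⊗ a`, contracting with `m` gives `ma - am`. This turns the relation `Δ =
λ` into a statement about Hochschild homology. -/
theorem contract_Delta (t : M ⊗[k] A) : contract k A M t (Delta k A) = hochB1 k A M t := by
  induction t with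
  | zero => simp
  | add x y hx hy => simp only [map_add, LinearMap.add_apply, hx, hy]
  | tmul m a => simp [contract_tmul, Delta_apply, hochB1_tmul]

/-- The Leibniz terms of `d(a a')` act on `m` as `d(a')` on `ma` and `d(a)` on `a'm`, which cancel
the other two terms of `b`. -/
theorem contract_hochB2 [SMulCommClass A Aᵐᵒᵖ M] (t : M ⊗[k] (A ⊗[k] A)) :
    contract k A M (hochB2 k A M t) = 0 := by
  suffices h : contract k A M ∘ₗ hochB2 k A M = 0 from LinearMap.congr_fun h t
  apply TensorProduct.ext_threefold'
  intro m a a'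
  ext d
  simp only [LinearMap.comp_apply, hochB2_tmul, map_add, map_sub, LinearMap.add_apply,
    LinearMap.sub_apply, contract_tmul, DoubleDer.leibniz, innerAct_left_mul,
    innerAct_mul_right, LinearMap.zero_apply]
  abel

/-- Every bimodule map out of the double derivations is a contraction. -/
theorem IsDualBasis.exists_contract_eq {ι : Type*} [Fintype ι] {x : ι → A}
    {d : ι → DoubleDer k A} (h : IsDualBasis x d) (g : DoubleDer k A →ₗ[k] M)
    (hl : ∀ (a : A) D, g (a • D) = a • g D)
    (hr : ∀ D (b : A), g (MulOpposite.op b • D) = MulOpposite.op b • g D) :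
    ∃ t, contract k A M t = g := by
  -- The witness is read off by applying `g` to `D = ∑ D(xᵢ)'' dᵢ D(xᵢ)'`.
  refine ⟨∑ i, g (d i) ⊗ₜ x i, LinearMap.ext fun D => ?_⟩
  conv_rhs => rw [h.eq_sum D]
  simp only [map_sum, LinearMap.sum_apply, contract_tmul, map_innerAct g hl hr]

/-- Modulo boundaries, `m ⊗ a` is `∑ dᵢ(a)'' m dᵢ(a)' ⊗ xᵢ`. -/
theorem IsDualBasis.tmul_sub_mem {ι : Type*} [Fintype ι] {x : ι → A}
    {d : ι → DoubleDer k A} (h : IsDualBasis x d) (m : M) (a : A) :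
    m ⊗ₜ a - ∑ i, innerAct k A M ((d i).toLin a) m ⊗ₜ[k] x i ∈
      LinearMap.range (hochB2 k A M) := by
  let π := (LinearMap.range (hochB2 k A M)).mkQ
  have hπ : ∀ t, π (hochB2 k A M t) = 0 := fun t =>
    (Submodule.Quotient.mk_eq_zero _).mpr ⟨t, rfl⟩
  -- Modulo boundaries, `n ⊗ a` behaves as a derivation in `a`.
  have hb : ∀ (n : M) (b c : A), π (n ⊗ₜ (b * c)) =
      π ((MulOpposite.op b • n) ⊗ₜ c) + π ((c • n) ⊗ₜ b) := by
    intro n b c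
    have := hπ (n ⊗ₜ (b ⊗ₜ c))
    rw [hochB2_tmul, map_add, map_sub] at this
    rw [← sub_eq_zero, ← neg_eq_zero, ← this]
    abel
  have hone : ∀ n : M, π (n ⊗ₜ 1) = 0 := fun n => by simpa using hb n 1 1
  -- Here `θ(p ⊗ q)` is the class of `mp ⊗ q`. By `hb` it sends `p Δ(y) q` to minus the class of
  -- `qmp ⊗ y`, so the formula for `Δ(a)` again yields the claim.
  let θ : A ⊗[k] A →ₗ[k] (M ⊗[k] A) ⧸ LinearMap.range (hochB2 k A M) :=
    π ∘ₗ TensorProduct.map ((Algebra.lsmul k k M).toLinearMap.flip m ∘ₗ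
      (MulOpposite.opLinearEquiv k).toLinearMap) LinearMap.id
  have hθ : ∀ p q, θ (p ⊗ₜ q) = π ((MulOpposite.op p • m) ⊗ₜ q) := fun _ _ => rfl
  have hΔ : ∀ t y, θ (outerAct k A t ((Delta k A).toLin y)) =
      -π (innerAct k A M t m ⊗ₜ y) := by
    intro t y
    induction t with
    | zero => simp
    | add s t hs ht =>
      simp only [map_add, LinearMap.add_apply, hs, ht, TensorProduct.add_tmul, neg_add]
    | tmul p q =>
      simp only [outerAct_tmul, Delta_apply,
        Algebra.TensorProduct.tmul_mul_tmul, one_mul, mul_one, map_sub, hθ, hb,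
        innerAct_tmul, MulOpposite.op_mul, mul_smul]
      abel
  rw [← Submodule.Quotient.mk_eq_zero, ← Submodule.mkQ_apply]
  change π _ = 0
  have h₁ := hΔ 1 a
  rw [outerAct_one, h a, map_sum, Algebra.TensorProduct.one_def, innerAct_tmul,
    MulOpposite.op_one, one_smul, one_smul] at h₁
  rw [map_sub, map_sum, ← neg_inj, neg_sub, sub_eq_add_neg, ← h₁, neg_zero,
    ← Finset.sum_add_distrib]
  exact Finset.sum_eq_zero fun i _ => by rw [hΔ, add_neg_cancel]

/-- The kernel of the contraction map consists of the Hochschild boundaries. -/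
theorem IsDualBasis.contract_eq_zero_iff [SMulCommClass A Aᵐᵒᵖ M] {ι : Type*} [Fintype ι]
    {x : ι → A} {d : ι → DoubleDer k A} (h : IsDualBasis x d) (t : M ⊗[k] A) :
    contract k A M t = 0 ↔ t ∈ LinearMap.range (hochB2 k A M) := by
  refine ⟨fun ht => ?_, ?_⟩
  -- Modulo boundaries, `t` is recovered from its contractions with the `dᵢ`.
  · have key : t - ∑ i, contract k A M t (d i) ⊗ₜ[k] x i ∈ LinearMap.range (hochB2 k A M) := by
      clear ht
      induction t with
      | zero => simp
      | add s t hs ht =>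
        convert add_mem hs ht using 1
        simp only [map_add, LinearMap.add_apply, TensorProduct.add_tmul, Finset.sum_add_distrib]
        abel
      | tmul m a => exact h.tmul_sub_mem m a
    simpa [ht] using key
  · rintro ⟨s, rfl⟩
    exact contract_hochB2 s

end Duality

/-! ### Extensions of a representation to the deformed preprojective algebra -/

section Extensions

variable {k : Type w} [Field k] {A : Type u} [Ring A] [Algebra k A]
  {B : Type v} [Ring B] [Algebra k B] {ρ : A →ₐ[k] B} {lam : A}

theorem subsingleton_HH1_iff (M : Type v) [AddCommGroup M] [Module k M] [Module A M]
    [Module Aᵐᵒᵖ M] [IsScalarTower k A M] [IsScalarTower k Aᵐᵒᵖ M] :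
    Subsingleton (HH1 k A M) ↔
      ∀ t, hochB1 k A M t = 0 → t ∈ LinearMap.range (hochB2 k A M) := by
  rw [Submodule.Quotient.subsingleton_iff, Submodule.submoduleOf, ← top_le_iff]
  exact ⟨fun h t ht => h (x := ⟨t, ht⟩) trivial, fun h t _ => h t.1 t.2⟩

theorem Preproj.hom_ext {σ τ : Preproj k lam →ₐ[k] B}
    (h : σ.comp (Preproj.mk k lam) = τ.comp (Preproj.mk k lam)) : σ = τ := by
  refine AlgHom.ext fun y => ?_
  obtain ⟨z, rfl⟩ := RingCon.mk'_surjective _ y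
  exact DFunLike.congr_fun h z

theorem Preproj.mk_Delta :
    Preproj.mk k lam (BimodTensorAlgebra.ofMod k A _ (Delta k A)) =
      Preproj.ofAlg k lam lam := by
  refine (RingCon.eq _).mpr ((TwoSidedIdeal.rel_iff _ _ _).mpr ?_)
  exact TwoSidedIdeal.subset_span rfl

/-- The bimodule map out of the double derivations determined by an extension of `ρ`. -/
noncomputable def extensionMap (ρ : A →ₐ[k] B) (σ : Preproj k lam →ₐ[k] B) :
    DoubleDer k A →ₗ[k] ViaHom ρ :=
  (ViaHom.of ρ).toLinearMap ∘ₗ σ.toLinearMap ∘ₗ (Preproj.mk k lam).toLinearMap ∘ₗ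
    BimodTensorAlgebra.ofMod k A (DoubleDer k A)

theorem extensionMap_apply (σ : Preproj k lam →ₐ[k] B) (D : DoubleDer k A) :
    extensionMap ρ σ D =
      ViaHom.of ρ (σ (Preproj.mk k lam (BimodTensorAlgebra.ofMod k A _ D))) := rfl

theorem Extends.apply_ofAlg {σ : Preproj k lam →ₐ[k] B} (h : Extends σ ρ) (a : A) :
    σ (Preproj.mk k lam (BimodTensorAlgebra.ofAlg k A _ a)) = ρ a :=
  DFunLike.congr_fun h a

theorem Extends.extensionMap_smul {σ : Preproj k lam →ₐ[k] B} (h : Extends σ ρ) (a : A)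
    (D : DoubleDer k A) : extensionMap ρ σ (a • D) = a • extensionMap ρ σ D := by
  rw [extensionMap_apply, extensionMap_apply, BimodTensorAlgebra.ofMod_smul, map_mul, map_mul,
    h.apply_ofAlg, ViaHom.smul_of]

theorem Extends.extensionMap_op_smul {σ : Preproj k lam →ₐ[k] B} (h : Extends σ ρ)
    (D : DoubleDer k A) (b : A) :
    extensionMap ρ σ (MulOpposite.op b • D) = MulOpposite.op b • extensionMap ρ σ D := by
  rw [extensionMap_apply, extensionMap_apply, BimodTensorAlgebra.ofMod_op_smul, map_mul,
    map_mul, h.apply_ofAlg, ViaHom.op_smul_of]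

theorem Extends.extensionMap_Delta {σ : Preproj k lam →ₐ[k] B} (h : Extends σ ρ) :
    extensionMap ρ σ (Delta k A) = ViaHom.of ρ (ρ lam) := by
  rw [extensionMap_apply, Preproj.mk_Delta]
  exact congrArg _ (h.apply_ofAlg lam)

/-- `Π^λ(A)` is generated by the images of `A` and of the double derivations, and on `A` both
extensions agree with `ρ`. -/
theorem Extends.ext_extensionMap {σ τ : Preproj k lam →ₐ[k] B} (hσ : Extends σ ρ)
    (hτ : Extends τ ρ) (h : extensionMap ρ σ = extensionMap ρ τ) : σ = τ := by
  apply Preproj.hom_ext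
  apply BimodTensorAlgebra.hom_ext
  · intro a
    exact (hσ.apply_ofAlg a).trans (hτ.apply_ofAlg a).symm
  · intro D
    exact (ViaHom.of ρ).injective (LinearMap.congr_fun h D)

/-- A bimodule map sending `Δ` to `ρ(lam)` comes from an extension of `ρ`. -/
theorem exists_extends_of_bimoduleMap (g : DoubleDer k A →ₗ[k] ViaHom ρ)
    (hl : ∀ (a : A) D, g (a • D) = a • g D)
    (hr : ∀ D (b : A), g (MulOpposite.op b • D) = MulOpposite.op b • g D)
    (hΔ : g (Delta k A) = ViaHom.of ρ (ρ lam)) :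
    ∃ σ : Preproj k lam →ₐ[k] B, Extends σ ρ ∧ extensionMap ρ σ = g := by
  let F : BimodTensorAlgebra k A (DoubleDer k A) →ₐ[k] B :=
    BimodTensorAlgebra.lift ρ ((ViaHom.of ρ).symm.toLinearMap ∘ₗ g)
      (fun a m => congrArg (ViaHom.of ρ).symm (hl a m))
      (fun m b => congrArg (ViaHom.of ρ).symm (hr m b))
  have hFA : ∀ a, F (BimodTensorAlgebra.ofAlg k A _ a) = ρ a :=
    BimodTensorAlgebra.lift_ofAlg _ _ _ _
  have hFM : ∀ D, F (BimodTensorAlgebra.ofMod k A _ D) = (ViaHom.of ρ).symm (g D) :=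
    BimodTensorAlgebra.lift_ofMod _ _ _ _
  have hF : preprojIdeal k lam ≤ TwoSidedIdeal.ker F := by
    rw [preprojIdeal, TwoSidedIdeal.span_le, Set.singleton_subset_iff, SetLike.mem_coe,
      TwoSidedIdeal.mem_ker, map_sub, hFA, hFM, hΔ, LinearEquiv.symm_apply_apply, sub_self]
  have hF' : (preprojIdeal k lam).ringCon ≤ RingCon.ker F.toRingHom := by
    intro x y hxy
    have h := hF ((TwoSidedIdeal.rel_iff _ _ _).mp hxy)
    rw [TwoSidedIdeal.mem_ker, map_sub, sub_eq_zero] at h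
    exact h
  exact ⟨RingCon.liftₐ _ F hF', AlgHom.ext hFA,
    LinearMap.ext fun D => congrArg (ViaHom.of ρ) (hFM D)⟩

/-- Extensions of `ρ` to `Π^lam(A)` exist precisely if `ρ(lam)` vanishes in `HH₀`. -/
theorem exists_extends_iff [Algebra.FiniteType k A] (hA : IsQuasiFree k A) :
    (∃ σ : Preproj k lam →ₐ[k] B, Extends σ ρ) ↔
      (Submodule.Quotient.mk (ViaHom.of ρ (ρ lam)) : HH0 k A (ViaHom ρ)) = 0 := by
  obtain ⟨s, d, hd⟩ := exists_isDualBasis hA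
  rw [Submodule.Quotient.mk_eq_zero]
  constructor
  · rintro ⟨σ, hσ⟩
    obtain ⟨t, ht⟩ := hd.exists_contract_eq _ hσ.extensionMap_smul hσ.extensionMap_op_smul
    exact ⟨t, by rw [← contract_Delta, ht, hσ.extensionMap_Delta]⟩
  -- This direction needs no dual basis: every contraction is a bimodule map, and its value at `Δ`
  -- is `b(t)`.
  · rintro ⟨t, ht⟩
    obtain ⟨σ, hσ, -⟩ := exists_extends_of_bimoduleMap (contract k A (ViaHom ρ) t)
      (contract_smul t) (contract_op_smul t) ((contract_Delta t).trans ht)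
    exact ⟨σ, hσ⟩

/-- If extensions of `ρ` to `Π^lam(A)` exist, uniqueness is the vanishing of `HH₁`. -/
theorem existsUnique_extends_iff [Algebra.FiniteType k A] (hA : IsQuasiFree k A)
    (hex : ∃ σ : Preproj k lam →ₐ[k] B, Extends σ ρ) :
    (∃! σ : Preproj k lam →ₐ[k] B, Extends σ ρ) ↔ Subsingleton (HH1 k A (ViaHom ρ)) := by
  obtain ⟨s, d, hd⟩ := exists_isDualBasis hA
  obtain ⟨σ, hσ⟩ := hex
  rw [subsingleton_HH1_iff]
  constructor
  · intro huniq t ht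
    rw [← hd.contract_eq_zero_iff]
    -- A cycle contracts to a bimodule map killing `Δ`, so adding it to the map of `σ` gives another
    -- extension; uniqueness forces that contraction to be zero.
    obtain ⟨τ, hτ, hτ'⟩ := exists_extends_of_bimoduleMap (ρ := ρ) (lam := lam)
      (extensionMap ρ σ + contract k A (ViaHom ρ) t)
      (fun a D => by
        simp only [LinearMap.add_apply, hσ.extensionMap_smul, contract_smul, smul_add])
      (fun D b => by
        simp only [LinearMap.add_apply, hσ.extensionMap_op_smul, contract_op_smul, smul_add])
      (by rw [LinearMap.add_apply, contract_Delta, ht, add_zero, hσ.extensionMap_Delta])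
    rw [huniq.unique hτ hσ] at hτ'
    exact left_eq_add.mp hτ'
  · intro h
    refine ⟨σ, hσ, fun τ hτ => hτ.ext_extensionMap hσ (sub_eq_zero.mp ?_)⟩
    -- The difference of two extension maps kills `Δ`, so it is the contraction of a cycle, which
    -- `h` makes a boundary.
    obtain ⟨t, ht⟩ := hd.exists_contract_eq (extensionMap ρ τ - extensionMap ρ σ)
      (fun a D => by
        simp only [LinearMap.sub_apply, hσ.extensionMap_smul, hτ.extensionMap_smul, smul_sub])
      (fun D b => by
        simp only [LinearMap.sub_apply, hσ.extensionMap_op_smul, hτ.extensionMap_op_smul,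
          smul_sub])
    rw [← ht, hd.contract_eq_zero_iff]
    apply h
    rw [← contract_Delta, ht, LinearMap.sub_apply, hσ.extensionMap_Delta,
      hτ.extensionMap_Delta, sub_self]

end Extensions

end DefPreproj

theorem mainTheorem6 {A : Type*} [Ring A] [Algebra ℂ A] [Algebra.FiniteType ℂ A]
    (hA : DefPreproj.IsQuasiFree ℂ A) {V : Type*} [AddCommGroup V] [Module ℂ V]
    (ρ : A →ₐ[ℂ] Module.End ℂ V) :
    (∀ lam : A,
      ((∃ σ : DefPreproj.Preproj ℂ lam →ₐ[ℂ] Module.End ℂ V, DefPreproj.Extends σ ρ) ↔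
        (Submodule.Quotient.mk (DefPreproj.ViaHom.of ρ (ρ lam)) :
          DefPreproj.HH0 ℂ A (DefPreproj.ViaHom ρ)) = 0) ∧
      ((∃ σ : DefPreproj.Preproj ℂ lam →ₐ[ℂ] Module.End ℂ V, DefPreproj.Extends σ ρ) →
        ((∃! σ : DefPreproj.Preproj ℂ lam →ₐ[ℂ] Module.End ℂ V, DefPreproj.Extends σ ρ) ↔
          Subsingleton (DefPreproj.HH1 ℂ A (DefPreproj.ViaHom ρ))))) ∧
    (∀ (wt : DefPreproj.Weight A ℂ) (lam : A),
      (Submodule.Quotient.mk lam : DefPreproj.HH0 ℂ A A) = DefPreproj.traceWeight A ℂ wt →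
      ((∃ σ : DefPreproj.Preproj ℂ lam →ₐ[ℂ] Module.End ℂ V, DefPreproj.Extends σ ρ) ↔
        DefPreproj.HH0map ρ (DefPreproj.traceWeight A ℂ wt) = 0) ∧
      ((∃ σ : DefPreproj.Preproj ℂ lam →ₐ[ℂ] Module.End ℂ V, DefPreproj.Extends σ ρ) →
        ((∃! σ : DefPreproj.Preproj ℂ lam →ₐ[ℂ] Module.End ℂ V, DefPreproj.Extends σ ρ) ↔
          Subsingleton (DefPreproj.HH1 ℂ A (DefPreproj.ViaHom ρ))))) := by
  refine ⟨fun lam => ⟨DefPreproj.exists_extends_iff hA,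
    DefPreproj.existsUnique_extends_iff hA⟩, fun wt lam hlam => ⟨?_,
    DefPreproj.existsUnique_extends_iff hA⟩⟩
  -- `HH0map` sends the class of `λ` to the class of `ρ(λ)` by definition, which leaves the
  -- criterion of the first part.
  rw [← hlam]
  exact DefPreproj.exists_extends_iff hA
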